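/- Let $n\ge 2$ and let $\Omega\subset\mathbb{R}^n$ be a bounded open set (for instance a connected bounded Lipschitz domain). For $\delta>0$ put $\Omega_\delta=\bigcup_{x\in\Omega}B(x,\delta)$, where $B(x,\delta)$ is the open Euclidean ball. Fix $\overline\delta>0$, and for each $\delta\in(0,\overline\delta)$ let $\omega_\delta:\mathbb{R}^n\to[0,\infty)$ be a measurable radial function vanishing outside $B(0,\delta)$ and normalized by $$\int_{\mathbb{R}^n}|x|^2\omega_\delta^2(x)\,\mathrm{d}x=K_{2,n}^{-1},\qquad K_{2,n}=\frac1{|\mathbb{S}^{n-1}|}\int_{\mathbb{S}^{n-1}}|s\cdot e|^2\,\mathrm{d}s,$$ where $e\in\mathbb{S}^{n-1}$ is an arbitrary unit vector. Extending functions on $\Omega$ by zero, let $\mathcal{G}_\delta u(x,x')=[u(x)-u(x')]\,\omega_\delta(x-x')$, considered as an unbounded linear operator from $L^2(\Omega)$ to $L^2(\Omega_\delta\times\Omega_\delta)$ with the domain $\mathbb{U}_{\delta,0}=\{u\in L^2(\Omega):\mathcal{G}_\delta u\in L^2(\Omega_\delta\times\Omega_\delta)\}$, which is dense in $L^2(\Omega)$.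 Let $\mathcal{D}_\delta$ be its negative adjoint, an unbounded operator from $L^2(\Omega_\delta\times\Omega_\delta)$ to $L^2(\Omega)$ with $$(\mathcal{D}_\delta \ddot q,v)_{L^2(\Omega)}=-(\ddot q,\mathcal{G}_\delta v)_{L^2(\Omega_\delta\times\Omega_\delta)}\qquad\text{for all } v\in\mathbb{U}_{\delta,0},$$ and let $\mathbb{Q}_\delta$ be the domain of $\mathcal{D}_\delta$, equipped with the graph norm $\|\ddot q\|_{\mathbb{Q}_\delta}^2=\|\ddot q\|_{L^2(\Omega_\delta\times\Omega_\delta)}^2+\|\mathcal{D}_\delta\ddot q\|_{L^2(\Omega)}^2$. For $\ddot q\in\mathbb{Q}_\delta$ and $v\in L^2(\Omega)$ put $$b(\ddot q,v)=-\int_\Omega\mathcal{D}_\delta\ddot q(x)\,v(x)\,\mathrm{d}x.$$ Then $b$ satisfies the inf-sup (Ladyzhenskaya--Babuška--Brezzi) condition uniformly in $\delta$: there is a constant $c>0$, independent of $\delta$, such that for every $\delta\in(0,\overline\delta)$ $$\inf_{v\in L^2(\Omega)\setminus\{0\}}\ \sup_{\ddot q\in\mathbb{Q}_\delta\setminus\{0\}}\frac{b(\ddot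 q,v)}{\|v\|_{L^2(\Omega)}\,\|\ddot q\|_{\mathbb{Q}_\delta}}\ \ge\ c.$$ -/

import Mathlib

open MeasureTheory
open scoped LinearPMap

noncomputable section

namespace NonlocalDiffusion

/-- The constant `K_{p,n} = |S^{n-1}|⁻¹ ∫_{S^{n-1}} |s · e|^p ds`, where `e` is a unit vector
(the value does not depend on which one). -/
def sphereMoment {n : ℕ} (p : ℝ) (e : EuclideanSpace ℝ (Fin n)) : ℝ :=
  ⨍ s : Metric.sphere (0 : EuclideanSpace ℝ (Fin n)) 1,
    |inner ℝ (s : EuclideanSpace ℝ (Fin n)) e| ^ p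
      ∂(volume : Measure (EuclideanSpace ℝ (Fin n))).toSphere

/-- `w` is an admissible interaction kernel of horizon `δ`: a non-negative radial function
vanishing outside the ball `B(0, δ)`, normalized by `∫ |x|² w(x)² dx = K_{2,n}⁻¹`. -/
structure IsKernel {n : ℕ} (δ : ℝ) (w : EuclideanSpace ℝ (Fin n) → ℝ) : Prop where
  measurable : Measurable w
  nonneg : ∀ x, 0 ≤ w x
  radial : ∀ x y, ‖x‖ = ‖y‖ → w x = w y
  support_subset : Function.support w ⊆ Metric.ball 0 δ
  normalized : ∀ e : EuclideanSpace ℝ (Fin n), ‖e‖ = 1 →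
    ∫ x, ‖x‖ ^ 2 * w x ^ 2 = (sphereMoment 2 e)⁻¹

variable {n : ℕ}

/-- The enlarged set `Ω_δ = ⋃_{x ∈ Ω} B(x, δ)`. -/
def enlarged (Ω : TopologicalSpace.Opens (EuclideanSpace ℝ (Fin n))) (δ : ℝ) :
    Set (EuclideanSpace ℝ (Fin n)) :=
  ⋃ x ∈ Ω, Metric.ball x δ

/-- `L²(Ω)`. -/
abbrev L2 (Ω : TopologicalSpace.Opens (EuclideanSpace ℝ (Fin n))) : Type :=
  Lp ℝ 2 ((volume : Measure (EuclideanSpace ℝ (Fin n))).restrict Ω)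

/-- Lebesgue measure on `Ω_δ × Ω_δ`. -/
abbrev pairMeasure (Ω : TopologicalSpace.Opens (EuclideanSpace ℝ (Fin n))) (δ : ℝ) :
    Measure (EuclideanSpace ℝ (Fin n) × EuclideanSpace ℝ (Fin n)) :=
  volume.restrict (enlarged Ω δ ×ˢ enlarged Ω δ)

/-- `L²(Ω_δ × Ω_δ)`, the space of two-point fluxes. -/
abbrev L2Pair (Ω : TopologicalSpace.Opens (EuclideanSpace ℝ (Fin n))) (δ : ℝ) : Type :=
  Lp ℝ 2 (pairMeasure Ω δ)

/-- The function `(x, x') ↦ [u(x) - u(x')] w(x - x')`, with `u` extended by zero outside `Ω`. -/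
def gradFun (Ω : TopologicalSpace.Opens (EuclideanSpace ℝ (Fin n)))
    (w : EuclideanSpace ℝ (Fin n) → ℝ) (u : EuclideanSpace ℝ (Fin n) → ℝ) :
    EuclideanSpace ℝ (Fin n) × EuclideanSpace ℝ (Fin n) → ℝ :=
  fun z => ((Ω : Set (EuclideanSpace ℝ (Fin n))).indicator u z.1
    - (Ω : Set (EuclideanSpace ℝ (Fin n))).indicator u z.2) * w (z.1 - z.2)

section Helpers

variable (Ω : TopologicalSpace.Opens (EuclideanSpace ℝ (Fin n))) (δ : ℝ)
  (w : EuclideanSpace ℝ (Fin n) → ℝ)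

/-- `gradFun` respects almost everywhere equality on `Ω`. -/
theorem gradFun_congr {u v : EuclideanSpace ℝ (Fin n) → ℝ}
    (h : u =ᵐ[volume.restrict (Ω : Set (EuclideanSpace ℝ (Fin n)))] v) :
    gradFun Ω w u =ᵐ[pairMeasure Ω δ] gradFun Ω w v := by
  have h' := (ae_eq_restrict_iff_indicator_ae_eq Ω.isOpen.measurableSet).1 h
  have h1 := (Measure.quasiMeasurePreserving_fst (μ := (volume : Measure (EuclideanSpace ℝ (Fin n))))
    (ν := (volume : Measure (EuclideanSpace ℝ (Fin n))))).ae_eq_comp h'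
  have h2 := (Measure.quasiMeasurePreserving_snd (μ := (volume : Measure (EuclideanSpace ℝ (Fin n))))
    (ν := (volume : Measure (EuclideanSpace ℝ (Fin n))))).ae_eq_comp h'
  refine ae_restrict_of_ae ?_
  filter_upwards [h1, h2] with z hz1 hz2
  simp only [Function.comp_apply] at hz1 hz2
  simp only [gradFun, hz1, hz2]

theorem gradFun_add (u v : EuclideanSpace ℝ (Fin n) → ℝ) :
    gradFun Ω w (u + v) = gradFun Ω w u + gradFun Ω w v := by
  funext z
  simp only [gradFun, Set.indicator_add', Pi.add_apply]
  ring

theorem gradFun_smul (c : ℝ) (u : EuclideanSpace ℝ (Fin n) → ℝ) :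
    gradFun Ω w (c • u) = c • gradFun Ω w u := by
  funext z
  have h : ∀ x, (Ω : Set (EuclideanSpace ℝ (Fin n))).indicator (c • u) x
      = c * (Ω : Set (EuclideanSpace ℝ (Fin n))).indicator u x := by
    intro x
    by_cases hx : x ∈ (Ω : Set (EuclideanSpace ℝ (Fin n))) <;> simp [hx]
  simp only [gradFun, h, Pi.smul_apply, smul_eq_mul]
  ring

end Helpers

/-- The domain `U_{δ,0} = {u ∈ L²(Ω) : G_δ u ∈ L²(Ω_δ × Ω_δ)}` of the nonlocal gradient. -/
def gradDomain (Ω : TopologicalSpace.Opens (EuclideanSpace ℝ (Fin n))) (δ : ℝ)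
    (w : EuclideanSpace ℝ (Fin n) → ℝ) : Submodule ℝ (L2 Ω) where
  carrier := {u | MemLp (gradFun Ω w u) 2 (pairMeasure Ω δ)}
  zero_mem' := by
    refine (memLp_congr_ae (gradFun_congr Ω δ w (Lp.coeFn_zero ℝ 2 _))).2 ?_
    have : gradFun Ω w (0 : EuclideanSpace ℝ (Fin n) → ℝ) = 0 := by
      funext z; simp [gradFun]
    rw [this]
    exact MemLp.zero
  add_mem' {u v} hu hv := by
    refine (memLp_congr_ae (gradFun_congr Ω δ w (Lp.coeFn_add u v))).2 ?_
    rw [gradFun_add]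
    exact MemLp.add hu hv
  smul_mem' c u hu := by
    refine (memLp_congr_ae (gradFun_congr Ω δ w (Lp.coeFn_smul c u))).2 ?_
    rw [gradFun_smul]
    exact MemLp.const_smul hu c

theorem memLp_gradFun {Ω : TopologicalSpace.Opens (EuclideanSpace ℝ (Fin n))} {δ : ℝ}
    {w : EuclideanSpace ℝ (Fin n) → ℝ} (u : gradDomain Ω δ w) :
    MemLp (gradFun Ω w (u : L2 Ω)) 2 (pairMeasure Ω δ) :=
  u.2

/-- The nonlocal gradient `G_δ u (x, x') = [u(x) - u(x')] w(x - x')`, an unbounded operator from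
`L²(Ω)` to `L²(Ω_δ × Ω_δ)` with domain `U_{δ,0}`. -/
def nonlocalGrad (Ω : TopologicalSpace.Opens (EuclideanSpace ℝ (Fin n))) (δ : ℝ)
    (w : EuclideanSpace ℝ (Fin n) → ℝ) : L2 Ω →ₗ.[ℝ] L2Pair Ω δ where
  domain := gradDomain Ω δ w
  toFun :=
    { toFun := fun u => MemLp.toLp (gradFun Ω w (u : L2 Ω)) (memLp_gradFun u)
      map_add' := fun u v => by
        rw [← MemLp.toLp_add (memLp_gradFun u) (memLp_gradFun v)]
        refine (MemLp.toLp_eq_toLp_iff _ _).2 ?_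
        have h := gradFun_congr Ω δ w (Lp.coeFn_add (u : L2 Ω) (v : L2 Ω))
        rw [gradFun_add] at h
        exact h
      map_smul' := fun c u => by
        rw [RingHom.id_apply, ← MemLp.toLp_const_smul c (memLp_gradFun u)]
        refine (MemLp.toLp_eq_toLp_iff _ _).2 ?_
        have h := gradFun_congr Ω δ w (Lp.coeFn_smul c (u : L2 Ω))
        rw [gradFun_smul] at h
        exact h }

/-- The nonlocal divergence `D_δ = -G_δ^*`, the negative adjoint of the densely defined operator
`G_δ`; an unbounded operator from `L²(Ω_δ × Ω_δ)` to `L²(Ω)`. -/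
def nonlocalDiv (Ω : TopologicalSpace.Opens (EuclideanSpace ℝ (Fin n))) (δ : ℝ)
    (w : EuclideanSpace ℝ (Fin n) → ℝ) : L2Pair Ω δ →ₗ.[ℝ] L2 Ω :=
  -(nonlocalGrad Ω δ w)†

/-- The flux space `Q_δ`, the domain of `D_δ`. -/
abbrev fluxSpace (Ω : TopologicalSpace.Opens (EuclideanSpace ℝ (Fin n))) (δ : ℝ)
    (w : EuclideanSpace ℝ (Fin n) → ℝ) : Submodule ℝ (L2Pair Ω δ) :=
  (nonlocalDiv Ω δ w).domain

/-- The norm of `Q_δ`, induced by the graph inner product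
`(q, p)_{Q_δ} = (q, p)_{L²(Ω_δ × Ω_δ)} + (D_δ q, D_δ p)_{L²(Ω)}`. -/
def fluxNorm (Ω : TopologicalSpace.Opens (EuclideanSpace ℝ (Fin n))) (δ : ℝ)
    (w : EuclideanSpace ℝ (Fin n) → ℝ) (q : fluxSpace Ω δ w) : ℝ :=
  Real.sqrt (inner ℝ (q : L2Pair Ω δ) (q : L2Pair Ω δ)
    + inner ℝ (nonlocalDiv Ω δ w q) (nonlocalDiv Ω δ w q))

/-- The form `b(q, v) = -∫_Ω D_δ q(x) v(x) dx` on `Q_δ × L²(Ω)`. -/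
def bForm (Ω : TopologicalSpace.Opens (EuclideanSpace ℝ (Fin n))) (δ : ℝ)
    (w : EuclideanSpace ℝ (Fin n) → ℝ) (q : fluxSpace Ω δ w) (v : L2 Ω) : ℝ :=
  -∫ x in (Ω : Set (EuclideanSpace ℝ (Fin n))), nonlocalDiv Ω δ w q x * v x

end NonlocalDiffusion

end

/-!
For `v ∈ L²(Ω)` a flux `q` is constructed with `D_δ q = -v` and `‖q‖ ≤ C ‖v‖`, where `C` does not
depend on `δ`. Then `b(q, v) = ‖v‖²` and `‖q‖_{Q_δ} ≤ (C² + 1)^{1/2} ‖v‖`, which gives the inf-sup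
condition with `c = (C² + 1)^{-1/2}`.

Since `D_δ` is the negative adjoint of the densely defined operator `G_δ`, such a flux exists as
soon as `‖u‖ ≤ C ‖G_δ u‖` on the domain of `G_δ`
(`LinearPMap.exists_adjoint_eq_of_norm_le`, by Hahn-Banach and Riesz). The domain is dense because
it contains the test functions (`dense_nonlocalGrad_domain`).

The lower bound is a nonlocal Poincaré inequality (`eLpNorm_le_eLpNorm_gradFun`), uniform for
`δ ≤ d`. Let `U` be the extension of `u` by zero, let `Ω ⊆ B(0, R)`, and let `τ_z` denote the
translation by `z`. For an integer `k` with `k |z| ≥ 2R` the functions `U` and `τ_z^k U` have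
disjoint supports, so that `‖U‖ ≤ ‖τ_z^k U - U‖ ≤ k ‖τ_z U - U‖`. The least such `k` satisfies
`k |z| ≤ 2R + |z|`, whence `|z| ‖U‖ ≤ (2R + d) ‖τ_z U - U‖` for `|z| ≤ d`. Squaring, multiplying by
`ω_δ(z)²` and integrating over `z` turns the left-hand side into `K_{2,n}⁻¹ ‖u‖²`, by the
normalization of the kernel, and the right-hand side into `(2R + d)² ‖G_δ u‖²`, by Tonelli's
theorem.
-/

open Metric
open scoped ENNReal

/-! ### Surjectivity of the adjoint of an operator bounded below -/

namespace LinearPMap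

/-- A densely defined operator that is bounded below has a surjective adjoint, with a bounded
right inverse. Neither closedness of `T` nor of its range is needed: the functional
`T x ↦ ⟪v, x⟫` on the range of `T` is extended to the whole space by Hahn-Banach. -/
theorem exists_adjoint_eq_of_norm_le {E F : Type*}
    [NormedAddCommGroup E] [InnerProductSpace ℝ E] [CompleteSpace E]
    [NormedAddCommGroup F] [InnerProductSpace ℝ F] [CompleteSpace F]
    (T : E →ₗ.[ℝ] F) (hT : Dense (T.domain : Set E)) {C : ℝ} (hC : 0 ≤ C)
    (hbelow : ∀ x : T.domain, ‖(x : E)‖ ≤ C * ‖T x‖) (v : E) :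
    ∃ y : T†.domain, T† y = v ∧ ‖(y : F)‖ ≤ C * ‖v‖ := by
  have hinj : Function.Injective T.toFun := by
    refine (injective_iff_map_eq_zero T.toFun).2 fun x hx => ?_
    have h := hbelow x
    have h0 : T x = 0 := hx
    rw [h0, norm_zero, mul_zero] at h
    exact Subtype.ext (norm_le_zero_iff.1 h)
  let e := LinearEquiv.ofInjective T.toFun hinj
  let f : StrongDual ℝ (LinearMap.range T.toFun) :=
    (((innerₛₗ ℝ v).comp T.domain.subtype).comp e.symm.toLinearMap).mkContinuous (C * ‖v‖) (by
      intro z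
      obtain ⟨x, rfl⟩ := e.surjective z
      have hx : ‖e x‖ = ‖T x‖ := rfl
      simp only [LinearMap.comp_apply, LinearEquiv.coe_coe, LinearEquiv.symm_apply_apply,
        Submodule.subtype_apply, innerₛₗ_apply_apply]
      calc ‖inner ℝ v (x : E)‖ ≤ ‖v‖ * ‖(x : E)‖ := norm_inner_le_norm _ _
        _ ≤ ‖v‖ * (C * ‖T x‖) := by gcongr; exact hbelow x
        _ = C * ‖v‖ * ‖e x‖ := by rw [hx]; ring)
  have hf : ∀ x : T.domain, f (e x) = inner ℝ v (x : E) := fun x => by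
    simp [f, LinearMap.mkContinuous_apply]
  obtain ⟨g, hg, hgn⟩ := exists_extension_norm_eq _ f
  let y : F := (InnerProductSpace.toDual ℝ F).symm g
  have hy : ∀ x : T.domain, inner ℝ v (x : E) = inner ℝ y (T x) := fun x => by
    rw [← hf x, ← hg (e x), InnerProductSpace.toDual_symm_apply]
    rfl
  refine ⟨⟨y, T.mem_adjoint_domain_of_exists y ⟨v, hy⟩⟩, adjoint_apply_eq hT _ hy, ?_⟩
  change ‖(InnerProductSpace.toDual ℝ F).symm g‖ ≤ _
  rw [LinearIsometryEquiv.norm_map, hgn]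
  exact LinearMap.mkContinuous_norm_le _ (by positivity) _

end LinearPMap

/-! ### Translation differences of functions with bounded support -/

section Translation

variable {E : Type*} [NormedAddCommGroup E] [MeasurableSpace E] {μ : Measure E}

theorem eLpNorm_translate_nsmul_sub_le [BorelSpace E] [μ.IsAddRightInvariant] {p : ℝ≥0∞}
    (hp : 1 ≤ p) {U : E → ℝ} (hU : Measurable U) (z : E) (k : ℕ) :
    eLpNorm (fun x => U (x + k • z) - U x) p μ
      ≤ k * eLpNorm (fun x => U (x + z) - U x) p μ := by
  induction k with
  | zero => simp
  | succ k ih =>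
    have hsplit : (fun x => U (x + (k + 1) • z) - U x)
        = (fun x => U (x + z) - U x) ∘ (fun x => x + k • z)
          + fun x => U (x + k • z) - U x := by
      funext x
      simp only [Function.comp_apply, Pi.add_apply, add_smul, one_smul, add_assoc]
      ring
    have hdiff : Measurable fun x => U (x + z) - U x :=
      (hU.comp (measurable_add_const z)).sub hU
    have hdiff' : Measurable fun x => U (x + k • z) - U x :=
      (hU.comp (measurable_add_const _)).sub hU
    calc eLpNorm (fun x => U (x + (k + 1) • z) - U x) p μ
        ≤ eLpNorm ((fun x => U (x + z) - U x) ∘ (fun x => x + k • z)) p μ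
          + eLpNorm (fun x => U (x + k • z) - U x) p μ := by
          rw [hsplit]
          exact eLpNorm_add_le (hdiff.comp (measurable_add_const _)).aestronglyMeasurable
            hdiff'.aestronglyMeasurable hp
      _ ≤ eLpNorm (fun x => U (x + z) - U x) p μ
          + k * eLpNorm (fun x => U (x + z) - U x) p μ := by
          rw [eLpNorm_comp_measurePreserving hdiff.aestronglyMeasurable
            (measurePreserving_add_right μ _)]
          gcongr
      _ = (k + 1 : ℕ) * eLpNorm (fun x => U (x + z) - U x) p μ := by
          push_cast; ring

/-- If the translation moves the support of `U` off itself, the difference dominates `U`. -/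
theorem eLpNorm_le_eLpNorm_translate_sub {p : ℝ≥0∞} {U : E → ℝ} {R : ℝ}
    (hsupp : Function.support U ⊆ ball 0 R) {y : E} (hy : 2 * R ≤ ‖y‖) :
    eLpNorm U p μ ≤ eLpNorm (fun x => U (x + y) - U x) p μ := by
  refine eLpNorm_mono fun x => ?_
  by_cases hx : U x = 0
  · simp [hx]
  have hxy : U (x + y) = 0 := by
    by_contra hxy
    have h1 : ‖x‖ < R := by simpa using hsupp hx
    have h2 : ‖x + y‖ < R := by simpa using hsupp hxy
    have h3 : ‖y‖ ≤ ‖x + y‖ + ‖x‖ := by simpa using norm_sub_le (x + y) x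
    linarith
  simp [hxy]

/-- Lower bound for the difference of a compactly supported function and its translate. The
translation by `z` is iterated `⌈2R / ‖z‖⌉` times, enough to separate the supports. -/
theorem enorm_mul_eLpNorm_le_eLpNorm_translate_sub [NormedSpace ℝ E] [BorelSpace E]
    [μ.IsAddRightInvariant] {p : ℝ≥0∞} (hp : 1 ≤ p) {U : E → ℝ} (hU : Measurable U) {R : ℝ}
    (hR : 0 ≤ R) (hsupp : Function.support U ⊆ ball 0 R) {d : ℝ} {z : E} (hz : ‖z‖ ≤ d) :
    ‖z‖ₑ * eLpNorm U p μ
      ≤ ENNReal.ofReal (2 * R + d) * eLpNorm (fun x => U (x + z) - U x) p μ := by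
  rcases eq_or_ne z 0 with rfl | hz0
  · simp
  have hzpos : 0 < ‖z‖ := norm_pos_iff.2 hz0
  set k : ℕ := ⌈2 * R / ‖z‖⌉₊
  have hk : 2 * R ≤ ‖k • z‖ := by
    rw [← Nat.cast_smul_eq_nsmul ℝ, norm_smul, Real.norm_natCast]
    exact (div_le_iff₀ hzpos).1 (Nat.le_ceil _)
  have hk' : ‖z‖ * k ≤ 2 * R + d := by
    have h : (k : ℝ) < 2 * R / ‖z‖ + 1 := Nat.ceil_lt_add_one (by positivity)
    calc ‖z‖ * k ≤ ‖z‖ * (2 * R / ‖z‖ + 1) := by gcongr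
      _ = 2 * R + ‖z‖ := by field_simp
      _ ≤ 2 * R + d := by gcongr
  have hk'' : ‖z‖ₑ * k ≤ ENNReal.ofReal (2 * R + d) := by
    rw [← ofReal_norm, ← ENNReal.ofReal_natCast, ← ENNReal.ofReal_mul (norm_nonneg z)]
    exact ENNReal.ofReal_le_ofReal hk'
  calc ‖z‖ₑ * eLpNorm U p μ
      ≤ ‖z‖ₑ * (k * eLpNorm (fun x => U (x + z) - U x) p μ) := by
        gcongr
        exact (eLpNorm_le_eLpNorm_translate_sub hsupp hk).trans
          (eLpNorm_translate_nsmul_sub_le hp hU z k)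
    _ = (‖z‖ₑ * k) * eLpNorm (fun x => U (x + z) - U x) p μ := by ring
    _ ≤ _ := by gcongr

end Translation

/-! ### The normalization of the kernel -/

theorem sq_eLpNorm_two {α : Type*} [MeasurableSpace α] {μ : Measure α} (f : α → ℝ) :
    eLpNorm f 2 μ ^ 2 = ∫⁻ x, ‖f x‖ₑ ^ 2 ∂μ := by
  simpa using eLpNorm_nnreal_pow_eq_lintegral (μ := μ) (f := f) (p := 2) two_ne_zero

namespace NonlocalDiffusion

variable {n : ℕ}

theorem sphereMoment_pos {p : ℝ} (hp : 0 < p) {e : EuclideanSpace ℝ (Fin n)} (he : ‖e‖ = 1) :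
    0 < sphereMoment p e := by
  have : Nontrivial (EuclideanSpace ℝ (Fin n)) := ⟨e, 0, by rintro rfl; simp at he⟩
  set σ := (volume : Measure (EuclideanSpace ℝ (Fin n))).toSphere
  have hcont : Continuous fun s : sphere (0 : EuclideanSpace ℝ (Fin n)) 1 =>
      |inner ℝ (s : EuclideanSpace ℝ (Fin n)) e| ^ p :=
    Continuous.rpow_const (by fun_prop) fun _ => Or.inr hp.le
  have hint : 0 < ∫ s : sphere (0 : EuclideanSpace ℝ (Fin n)) 1,
      |inner ℝ (s : EuclideanSpace ℝ (Fin n)) e| ^ p ∂σ := by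
    refine hcont.integral_pos_of_hasCompactSupport_nonneg_nonzero
      (HasCompactSupport.of_compactSpace _) (fun s => by positivity)
      (x := ⟨e, by simpa using he⟩) ?_
    simp [he]
  have hσ : σ ≠ 0 := Measure.toSphere_ne_zero _
  have : NeZero σ := ⟨hσ⟩
  rw [sphereMoment, average_eq, smul_eq_mul]
  exact mul_pos (inv_pos.2 measureReal_univ_pos) hint

theorem IsKernel.lintegral_eq {δ : ℝ} {w : EuclideanSpace ℝ (Fin n) → ℝ} (hw : IsKernel δ w)
    {e : EuclideanSpace ℝ (Fin n)} (he : ‖e‖ = 1) :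
    ∫⁻ z, ‖z‖ₑ ^ 2 * ‖w z‖ₑ ^ 2 = ENNReal.ofReal (sphereMoment 2 e)⁻¹ := by
  -- a nonzero Bochner integral, hence that of an integrable function
  have hne : ∫ x, ‖x‖ ^ 2 * w x ^ 2 ≠ 0 := by
    rw [hw.normalized e he]
    exact inv_ne_zero (sphereMoment_pos two_pos he).ne'
  rw [← hw.normalized e he, ofReal_integral_eq_lintegral_ofReal
    (not_imp_comm.1 integral_undef hne) (ae_of_all _ fun x => by positivity)]
  refine lintegral_congr fun z => ?_
  rw [ENNReal.ofReal_mul (by positivity), ENNReal.ofReal_pow (norm_nonneg z),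
    ENNReal.ofReal_pow (hw.nonneg z), ofReal_norm, Real.enorm_of_nonneg (hw.nonneg z)]

/-! ### The nonlocal Poincaré inequality -/

theorem isOpen_enlarged (Ω : TopologicalSpace.Opens (EuclideanSpace ℝ (Fin n))) (δ : ℝ) :
    IsOpen (enlarged Ω δ) :=
  isOpen_biUnion fun _ _ => isOpen_ball

theorem isBounded_enlarged {Ω : TopologicalSpace.Opens (EuclideanSpace ℝ (Fin n))}
    (hΩ : Bornology.IsBounded (Ω : Set (EuclideanSpace ℝ (Fin n)))) (δ : ℝ) :
    Bornology.IsBounded (enlarged Ω δ) :=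
  hΩ.thickening.subset
    (Set.iUnion₂_subset_iff.2 fun _ hx => ball_subset_thickening hx δ)

theorem mem_enlarged_of_dist_lt {Ω : TopologicalSpace.Opens (EuclideanSpace ℝ (Fin n))} {δ : ℝ}
    {x y : EuclideanSpace ℝ (Fin n)} (hx : x ∈ Ω) (hxy : dist y x < δ) : y ∈ enlarged Ω δ :=
  Set.mem_biUnion hx hxy

/-- A nonlocal gradient vanishes outside `Ω_δ × Ω_δ`: one of the two points has to lie in `Ω`,
and the other one at a distance less than `δ` from it. -/
theorem support_gradFun_subset (Ω : TopologicalSpace.Opens (EuclideanSpace ℝ (Fin n))) {δ : ℝ}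
    {w : EuclideanSpace ℝ (Fin n) → ℝ} (hw : IsKernel δ w) (u : EuclideanSpace ℝ (Fin n) → ℝ) :
    Function.support (gradFun Ω w u) ⊆ enlarged Ω δ ×ˢ enlarged Ω δ := by
  rintro ⟨x, y⟩ hxy
  rw [Function.mem_support, gradFun, mul_ne_zero_iff] at hxy
  have hdist : dist x y < δ := by
    simpa [dist_eq_norm] using hw.support_subset hxy.2
  have hδ : 0 < δ := dist_nonneg.trans_lt hdist
  by_cases hx : x ∈ Ω
  · exact ⟨mem_enlarged_of_dist_lt hx (by simpa using hδ),
      mem_enlarged_of_dist_lt hx (by rwa [dist_comm])⟩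
  by_cases hy : y ∈ Ω
  · exact ⟨mem_enlarged_of_dist_lt hy hdist, mem_enlarged_of_dist_lt hy (by simpa using hδ)⟩
  · simp [hx, hy] at hxy

theorem measurable_gradFun (Ω : TopologicalSpace.Opens (EuclideanSpace ℝ (Fin n)))
    {w u : EuclideanSpace ℝ (Fin n) → ℝ} (hw : Measurable w) (hu : Measurable u) :
    Measurable (gradFun Ω w u) := by
  have hU := hu.indicator Ω.isOpen.measurableSet
  exact ((hU.comp measurable_fst).sub (hU.comp measurable_snd)).mul
    (hw.comp (measurable_fst.sub measurable_snd))

/-- Tonelli's theorem after the change of variables `(x, y) ↦ (x - y, y)`. -/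
theorem lintegral_prod_eq_lintegral_translate
    {f : EuclideanSpace ℝ (Fin n) × EuclideanSpace ℝ (Fin n) → ℝ≥0∞} (hf : Measurable f) :
    ∫⁻ p, f p = ∫⁻ z, ∫⁻ y, f (y + z, y) := by
  have hf' : Measurable fun q : EuclideanSpace ℝ (Fin n) × EuclideanSpace ℝ (Fin n) =>
      f (q.2 + q.1, q.2) := by fun_prop
  rw [Measure.volume_eq_prod, lintegral_prod_symm' f hf,
    lintegral_lintegral_swap (f := fun z y => f (y + z, y)) hf'.aemeasurable]
  refine lintegral_congr fun y => ?_
  exact (lintegral_add_left_eq_self (fun x => f (x, y)) y).symm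

/-- The squared norm of the nonlocal gradient is the integral over `z` of the squared norms of the
translation differences, weighted by `w(z)²`. -/
theorem sq_eLpNorm_gradFun (Ω : TopologicalSpace.Opens (EuclideanSpace ℝ (Fin n))) {δ : ℝ}
    {w : EuclideanSpace ℝ (Fin n) → ℝ} (hw : IsKernel δ w)
    {u : EuclideanSpace ℝ (Fin n) → ℝ} (hu : Measurable u) :
    eLpNorm (gradFun Ω w u) 2 (pairMeasure Ω δ) ^ 2
      = ∫⁻ z, ‖w z‖ₑ ^ 2 * eLpNorm
          (fun y => (Ω : Set (EuclideanSpace ℝ (Fin n))).indicator u (y + z)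
            - (Ω : Set (EuclideanSpace ℝ (Fin n))).indicator u y) 2 volume ^ 2 := by
  have hmeas := measurable_gradFun Ω hw.measurable hu
  have hE := (isOpen_enlarged Ω δ).measurableSet
  rw [sq_eLpNorm_two, pairMeasure, setLIntegral_eq_of_support_subset,
    lintegral_prod_eq_lintegral_translate (by fun_prop)]
  · refine lintegral_congr fun z => ?_
    have hU := hu.indicator Ω.isOpen.measurableSet
    rw [sq_eLpNorm_two, ← lintegral_const_mul _ (by fun_prop)]
    refine lintegral_congr fun y => ?_
    simp only [gradFun, add_sub_cancel_left, enorm_mul]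
    ring
  · intro p hp
    refine support_gradFun_subset Ω hw u fun h => hp ?_
    simp [h]

/-- Nonlocal Poincaré inequality, with a constant depending on the horizon only through an upper
bound `d`. -/
theorem eLpNorm_le_eLpNorm_gradFun {Ω : TopologicalSpace.Opens (EuclideanSpace ℝ (Fin n))} {R : ℝ}
    (hR : 0 ≤ R) (hΩ : (Ω : Set (EuclideanSpace ℝ (Fin n))) ⊆ ball 0 R) {δ d : ℝ} (hδ : δ ≤ d)
    {w : EuclideanSpace ℝ (Fin n) → ℝ} (hw : IsKernel δ w)
    {e : EuclideanSpace ℝ (Fin n)} (he : ‖e‖ = 1)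
    {u : EuclideanSpace ℝ (Fin n) → ℝ} (hu : Measurable u) :
    ENNReal.ofReal (sphereMoment 2 e)⁻¹ * eLpNorm u 2 (volume.restrict Ω) ^ 2
      ≤ ENNReal.ofReal (2 * R + d) ^ 2
        * eLpNorm (gradFun Ω w u) 2 (pairMeasure Ω δ) ^ 2 := by
  have hwm := hw.measurable
  have hU := hu.indicator Ω.isOpen.measurableSet
  rw [sq_eLpNorm_gradFun Ω hw hu, ← hw.lintegral_eq he,
    ← lintegral_mul_const _ (by fun_prop), ← lintegral_const_mul' _ _ (by simp)]
  refine lintegral_mono fun z => ?_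
  by_cases hz : w z = 0
  · simp [hz]
  have hzd : ‖z‖ ≤ d := by
    have : ‖z‖ < δ := by simpa using hw.support_subset hz
    linarith
  have h := enorm_mul_eLpNorm_le_eLpNorm_translate_sub (μ := volume) (p := 2) one_le_two hU hR
    (Set.support_indicator_subset.trans hΩ) hzd
  rw [eLpNorm_indicator_eq_eLpNorm_restrict Ω.isOpen.measurableSet] at h
  calc ‖z‖ₑ ^ 2 * ‖w z‖ₑ ^ 2 * eLpNorm u 2 (volume.restrict Ω) ^ 2
      = ‖w z‖ₑ ^ 2 * (‖z‖ₑ * eLpNorm u 2 (volume.restrict Ω)) ^ 2 := by ring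
    _ ≤ ‖w z‖ₑ ^ 2 * (ENNReal.ofReal (2 * R + d) * eLpNorm
          (fun y => (Ω : Set (EuclideanSpace ℝ (Fin n))).indicator u (y + z)
            - (Ω : Set (EuclideanSpace ℝ (Fin n))).indicator u y) 2 volume) ^ 2 := by gcongr
    _ = _ := by ring

/-- The constant of the nonlocal Poincaré inequality for subsets of `B(0, R)` and horizons up to
`d`. -/
noncomputable def poincareConst (R d : ℝ) (e : EuclideanSpace ℝ (Fin n)) : ℝ :=
  Real.sqrt (sphereMoment 2 e) * (2 * R + d)

theorem norm_le_norm_nonlocalGrad {Ω : TopologicalSpace.Opens (EuclideanSpace ℝ (Fin n))} {R : ℝ}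
    (hR : 0 ≤ R) (hΩ : (Ω : Set (EuclideanSpace ℝ (Fin n))) ⊆ ball 0 R) {δ d : ℝ} (hd : 0 ≤ d)
    (hδ : δ ≤ d) {w : EuclideanSpace ℝ (Fin n) → ℝ} (hw : IsKernel δ w)
    {e : EuclideanSpace ℝ (Fin n)} (he : ‖e‖ = 1) (u : (nonlocalGrad Ω δ w).domain) :
    ‖(u : L2 Ω)‖ ≤ poincareConst R d e * ‖nonlocalGrad Ω δ w u‖ := by
  have hK := sphereMoment_pos two_pos he
  have hu : Measurable (u : L2 Ω) := (Lp.stronglyMeasurable (u : L2 Ω)).measurable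
  have h := eLpNorm_le_eLpNorm_gradFun hR hΩ hδ hw he hu
  have hgrad : ‖nonlocalGrad Ω δ w u‖
      = (eLpNorm (gradFun Ω w (u : L2 Ω)) 2 (pairMeasure Ω δ)).toReal :=
    Lp.norm_toLp _ (memLp_gradFun u)
  have h' := ENNReal.toReal_mono
    (ENNReal.mul_ne_top (by simp) (ENNReal.pow_ne_top (memLp_gradFun u).2.ne)) h
  simp only [ENNReal.toReal_mul, ENNReal.toReal_pow, ← hgrad, ← Lp.norm_def] at h'
  rw [ENNReal.toReal_ofReal (by positivity), ENNReal.toReal_ofReal (by positivity),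
    inv_mul_le_iff₀ hK] at h'
  refine le_of_sq_le_sq ?_ (by unfold poincareConst; positivity)
  calc ‖(u : L2 Ω)‖ ^ 2 ≤ _ := h'
    _ = _ := by rw [poincareConst, mul_pow, mul_pow, Real.sq_sqrt hK.le]; ring

/-! ### Density of the domain of the nonlocal gradient -/

/-- Lipschitz functions have finite nonlocal energy, by the normalization of the kernel. -/
theorem memLp_gradFun_of_lipschitz {Ω : TopologicalSpace.Opens (EuclideanSpace ℝ (Fin n))}
    (hΩ : Bornology.IsBounded (Ω : Set (EuclideanSpace ℝ (Fin n)))) {δ : ℝ}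
    {w : EuclideanSpace ℝ (Fin n) → ℝ} (hw : IsKernel δ w)
    {e : EuclideanSpace ℝ (Fin n)} (he : ‖e‖ = 1)
    {g : EuclideanSpace ℝ (Fin n) → ℝ} {C : NNReal} (hg : LipschitzWith C g)
    (hsupp : Function.support g ⊆ Ω) :
    MemLp (gradFun Ω w g) 2 (pairMeasure Ω δ) := by
  have hwm := hw.measurable
  have hgm := hg.continuous.measurable
  have hEm := (isOpen_enlarged Ω δ).measurableSet
  have hone : Measurable ((enlarged Ω δ).indicator (1 : EuclideanSpace ℝ (Fin n) → ℝ≥0∞)) :=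
    measurable_one.indicator hEm
  have hind : (Ω : Set (EuclideanSpace ℝ (Fin n))).indicator g = g :=
    Set.indicator_eq_self.2 hsupp
  refine ⟨(measurable_gradFun Ω hwm hgm).aestronglyMeasurable, ?_⟩
  refine (ENNReal.pow_lt_top_iff.1 ?_).resolve_right two_ne_zero
  rw [sq_eLpNorm_two]
  have hbound : ∀ p, ‖gradFun Ω w g p‖ₑ ^ 2
      ≤ C ^ 2 * (‖p.1 - p.2‖ₑ ^ 2 * ‖w (p.1 - p.2)‖ₑ ^ 2) := by
    intro p
    have h : ‖g p.1 - g p.2‖ₑ ≤ C * ‖p.1 - p.2‖ₑ := by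
      simpa [edist_eq_enorm_sub] using hg p.1 p.2
    rw [gradFun, hind, enorm_mul]
    calc (‖g p.1 - g p.2‖ₑ * ‖w (p.1 - p.2)‖ₑ) ^ 2
        ≤ (C * ‖p.1 - p.2‖ₑ * ‖w (p.1 - p.2)‖ₑ) ^ 2 := by gcongr
      _ = _ := by ring
  -- one of the two points is allowed to range over the whole space, so that the integral factors
  calc ∫⁻ p, ‖gradFun Ω w g p‖ₑ ^ 2 ∂pairMeasure Ω δ
      ≤ ∫⁻ p in Set.univ ×ˢ enlarged Ω δ,
          C ^ 2 * (‖p.1 - p.2‖ₑ ^ 2 * ‖w (p.1 - p.2)‖ₑ ^ 2) :=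
        (lintegral_mono hbound).trans
          (lintegral_mono_set (Set.prod_mono_left (Set.subset_univ _)))
    _ = ∫⁻ p : EuclideanSpace ℝ (Fin n) × EuclideanSpace ℝ (Fin n),
          (enlarged Ω δ).indicator (1 : EuclideanSpace ℝ (Fin n) → ℝ≥0∞) p.2
          * (C ^ 2 * (‖p.1 - p.2‖ₑ ^ 2 * ‖w (p.1 - p.2)‖ₑ ^ 2)) := by
        rw [← lintegral_indicator (MeasurableSet.univ.prod hEm)]
        refine lintegral_congr fun p => ?_
        by_cases hp : p.2 ∈ enlarged Ω δ <;> simp [hp, Set.indicator]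
    _ = ∫⁻ z, (C ^ 2 * volume (enlarged Ω δ)) * (‖z‖ₑ ^ 2 * ‖w z‖ₑ ^ 2) := by
        rw [lintegral_prod_eq_lintegral_translate (by fun_prop)]
        refine lintegral_congr fun z => ?_
        simp only [add_sub_cancel_left]
        rw [lintegral_mul_const _ (by fun_prop), lintegral_indicator_one hEm]
        ring
    _ < ⊤ := by
        rw [lintegral_const_mul _ (by fun_prop), hw.lintegral_eq he]
        exact ENNReal.mul_lt_top (ENNReal.mul_lt_top (by simp)
          (isBounded_enlarged hΩ δ).measure_lt_top) ENNReal.ofReal_lt_top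

/-- The domain of the nonlocal gradient is dense, since it contains the test functions on `Ω`. -/
theorem dense_nonlocalGrad_domain {Ω : TopologicalSpace.Opens (EuclideanSpace ℝ (Fin n))}
    (hΩ : Bornology.IsBounded (Ω : Set (EuclideanSpace ℝ (Fin n)))) {δ : ℝ}
    {w : EuclideanSpace ℝ (Fin n) → ℝ} (hw : IsKernel δ w)
    {e : EuclideanSpace ℝ (Fin n)} (he : ‖e‖ = 1) :
    Dense ((nonlocalGrad Ω δ w).domain : Set (L2 Ω)) := by
  rw [Submodule.dense_iff_topologicalClosure_eq_top, Submodule.topologicalClosure_eq_top_iff,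
    Submodule.eq_bot_iff]
  intro v hv
  have hfin : IsFiniteMeasure
      ((volume : Measure (EuclideanSpace ℝ (Fin n))).restrict Ω) :=
    isFiniteMeasure_restrict.2 hΩ.measure_lt_top.ne
  have hvloc : LocallyIntegrableOn v (Ω : Set (EuclideanSpace ℝ (Fin n))) volume :=
    IntegrableOn.locallyIntegrableOn ((Lp.memLp v).integrable one_le_two)
  refine (Lp.eq_zero_iff_ae_eq_zero).2 ((ae_restrict_iff' Ω.isOpen.measurableSet).2
    (Ω.isOpen.ae_eq_zero_of_integral_contDiff_smul_eq_zero hvloc fun g hg hgc hgs => ?_))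
  have hsupp : Function.support g ⊆ Ω := (subset_tsupport g).trans hgs
  obtain ⟨C, hC⟩ := hg.lipschitzWith_of_hasCompactSupport hgc (by simp)
  have hgmem : MemLp g 2 (volume.restrict (Ω : Set (EuclideanSpace ℝ (Fin n)))) :=
    hg.continuous.memLp_of_hasCompactSupport hgc
  have hdom : hgmem.toLp g ∈ (nonlocalGrad Ω δ w).domain :=
    (memLp_congr_ae (gradFun_congr Ω δ w hgmem.coeFn_toLp)).2
      (memLp_gradFun_of_lipschitz hΩ hw he hC hsupp)
  have h := (Submodule.mem_orthogonal _ _).1 hv _ hdom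
  rw [L2.inner_def] at h
  rw [← setIntegral_eq_integral_of_forall_compl_eq_zero
    (s := (Ω : Set (EuclideanSpace ℝ (Fin n)))), ← h]
  · refine integral_congr_ae ?_
    filter_upwards [hgmem.coeFn_toLp] with x hx
    simp [hx, mul_comm]
  · intro x hx
    have : g x = 0 := by
      by_contra h0
      exact hx (hsupp h0)
    simp [this]

/-! ### The inf-sup condition -/

theorem bForm_eq_neg_inner (Ω : TopologicalSpace.Opens (EuclideanSpace ℝ (Fin n))) (δ : ℝ)
    (w : EuclideanSpace ℝ (Fin n) → ℝ) (q : fluxSpace Ω δ w) (v : L2 Ω) :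
    bForm Ω δ w q v = -inner ℝ (nonlocalDiv Ω δ w q) v := by
  rw [bForm, L2.inner_def]
  congr 1
  refine integral_congr_ae (ae_of_all _ fun x => ?_)
  simp [mul_comm]

/-- Bounded right inverse of the divergence; the bound depends on the horizon only through the
upper bound `d`. -/
theorem exists_nonlocalDiv_eq_neg {Ω : TopologicalSpace.Opens (EuclideanSpace ℝ (Fin n))} {R : ℝ}
    (hR : 0 ≤ R) (hΩ : (Ω : Set (EuclideanSpace ℝ (Fin n))) ⊆ ball 0 R) {δ d : ℝ} (hd : 0 ≤ d)
    (hδ : δ ≤ d) {w : EuclideanSpace ℝ (Fin n) → ℝ} (hw : IsKernel δ w)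
    {e : EuclideanSpace ℝ (Fin n)} (he : ‖e‖ = 1) (v : L2 Ω) :
    ∃ q : fluxSpace Ω δ w, nonlocalDiv Ω δ w q = -v ∧
      ‖(q : L2Pair Ω δ)‖ ≤ poincareConst R d e * ‖v‖ := by
  obtain ⟨q, hq, hqn⟩ := (nonlocalGrad Ω δ w).exists_adjoint_eq_of_norm_le
    (dense_nonlocalGrad_domain (isBounded_ball.subset hΩ) hw he)
    (by unfold poincareConst; positivity)
    (norm_le_norm_nonlocalGrad hR hΩ hd hδ hw he) v
  refine ⟨q, ?_, hqn⟩
  rw [← hq]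
  rfl

end NonlocalDiffusion

theorem mainTheorem3 {n : ℕ} (hn : 2 ≤ n)
    (Ω : TopologicalSpace.Opens (EuclideanSpace ℝ (Fin n)))
    (hΩ : Bornology.IsBounded (Ω : Set (EuclideanSpace ℝ (Fin n))))
    (δbar : ℝ) (hδbar : 0 < δbar)
    (ω : ℝ → EuclideanSpace ℝ (Fin n) → ℝ)
    (hω : ∀ δ ∈ Set.Ioo 0 δbar, NonlocalDiffusion.IsKernel δ (ω δ)) :
    ∃ c : ℝ, 0 < c ∧ ∀ δ ∈ Set.Ioo 0 δbar,
      (c : EReal) ≤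
        ⨅ (v : NonlocalDiffusion.L2 Ω) (_ : v ≠ 0),
          ⨆ (q : NonlocalDiffusion.fluxSpace Ω δ (ω δ)) (_ : q ≠ 0),
            ((NonlocalDiffusion.bForm Ω δ (ω δ) q v /
              (‖v‖ * NonlocalDiffusion.fluxNorm Ω δ (ω δ) q) : ℝ) : EReal) := by
  obtain ⟨R, hR, hΩR⟩ : ∃ R : ℝ, 0 < R ∧ (Ω : Set (EuclideanSpace ℝ (Fin n))) ⊆ ball 0 R :=
    hΩ.subset_ball_lt 0 0
  let e : EuclideanSpace ℝ (Fin n) := EuclideanSpace.single ⟨0, by omega⟩ 1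
  have he : ‖e‖ = 1 := by simp [e]
  set C := NonlocalDiffusion.poincareConst R δbar e
  refine ⟨(Real.sqrt (C ^ 2 + 1))⁻¹, by positivity, fun δ hδ => le_iInf₂ fun v hv => ?_⟩
  have hvpos : 0 < ‖v‖ := norm_pos_iff.2 hv
  obtain ⟨q, hq, hqn⟩ :=
    NonlocalDiffusion.exists_nonlocalDiv_eq_neg hR.le hΩR hδbar.le hδ.2.le (hω δ hδ) he v
  have hq0 : q ≠ 0 := by
    rintro rfl
    rw [LinearPMap.map_zero] at hq
    exact hv (neg_eq_zero.1 hq.symm)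
  refine le_iSup₂_of_le q hq0 (EReal.coe_le_coe_iff.2 ?_)
  have hb : NonlocalDiffusion.bForm Ω δ (ω δ) q v = ‖v‖ ^ 2 := by
    rw [NonlocalDiffusion.bForm_eq_neg_inner, hq, inner_neg_left, neg_neg,
      real_inner_self_eq_norm_sq]
  have hflux : NonlocalDiffusion.fluxNorm Ω δ (ω δ) q
      = Real.sqrt (‖(q : NonlocalDiffusion.L2Pair Ω δ)‖ ^ 2 + ‖v‖ ^ 2) := by
    rw [NonlocalDiffusion.fluxNorm, hq, inner_neg_neg, real_inner_self_eq_norm_sq,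
      real_inner_self_eq_norm_sq]
  have hfluxpos : 0 < NonlocalDiffusion.fluxNorm Ω δ (ω δ) q := by
    rw [hflux]; positivity
  have hfluxle : NonlocalDiffusion.fluxNorm Ω δ (ω δ) q ≤ Real.sqrt (C ^ 2 + 1) * ‖v‖ := by
    rw [hflux, ← Real.sqrt_sq hvpos.le, ← Real.sqrt_mul (by positivity), Real.sqrt_sq hvpos.le]
    refine Real.sqrt_le_sqrt ?_
    calc ‖(q : NonlocalDiffusion.L2Pair Ω δ)‖ ^ 2 + ‖v‖ ^ 2
        ≤ (C * ‖v‖) ^ 2 + ‖v‖ ^ 2 := by gcongr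
      _ = (C ^ 2 + 1) * ‖v‖ ^ 2 := by ring
  rw [hb, le_div_iff₀ (by positivity), inv_mul_le_iff₀ (by positivity)]
  calc ‖v‖ * NonlocalDiffusion.fluxNorm Ω δ (ω δ) q
      ≤ ‖v‖ * (Real.sqrt (C ^ 2 + 1) * ‖v‖) := by gcongr
    _ = Real.sqrt (C ^ 2 + 1) * ‖v‖ ^ 2 := by ring
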